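/- Theorem. For an integer $d\ge 0$ let $PW(\mathbb{R}^d)$ denote the class of $L^2$ functions on $\mathbb{R}^d$ with bounded spectrum, that is, of all functions $f:\mathbb{R}^d\to\mathbb{C}$ of the form $$f(t)=\int_B g(u)\,e^{i(u,t)}\,du,\qquad t\in\mathbb{R}^d,$$ where $g\in L^2(\mathbb{R}^d)$ is complex-valued, $B\subset\mathbb{R}^d$ is a ball of positive radius, and $(u,t)$ is the inner product. Let $m,n\ge 0$ be integers and let $\varphi:\mathbb{R}^m\to\mathbb{R}^n$ be a continuous map. Then $f\circ\varphi\in PW(\mathbb{R}^m)$ for every $f\in PW(\mathbb{R}^n)$ if and only if $\varphi$ is an injective affine map. In particular: (a) if $n<m$, there is no continuous map $\varphi:\mathbb{R}^m\to\mathbb{R}^n$ such that $f\circ\varphi\in PW(\mathbb{R}^m)$ for every $f\in PW(\mathbb{R}^n)$; (b) if $m=n$, a continuous map $\varphi:\mathbb{R}^n\to\mathbb{R}^n$ (not assumed to be a homeomorphism) satisfies $f\circ\varphi\in PW(\mathbb{R}^n)$ for every $f\in PW(\mathbb{R}^n)$ if and only if $\varphi$ is an invertible affine map. -/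

import Mathlib

/-- `MemPW n f` says that `f` belongs to the class `PW(ℝⁿ)` of `L²` functions with bounded
spectrum: there are `g ∈ L²(ℝⁿ)` and a ball `B ⊆ ℝⁿ` such that
`f t = ∫_B g u * exp (i (u, t)) du` for every `t ∈ ℝⁿ`. -/
def MemPW (n : ℕ) (f : EuclideanSpace ℝ (Fin n) → ℂ) : Prop :=
  ∃ (g : EuclideanSpace ℝ (Fin n) → ℂ) (c : EuclideanSpace ℝ (Fin n)) (r : ℝ),
    MeasureTheory.MemLp g 2 MeasureTheory.volume ∧ 0 < r ∧
    ∀ t, f t = ∫ u in Metric.ball c r, g u * Complex.exp (Complex.I * ((inner ℝ u t : ℝ) : ℂ))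

/-- Superposition with `φ : ℝᵐ → ℝⁿ` maps `PW(ℝⁿ)` into `PW(ℝᵐ)`. -/
def PreservesPW {m n : ℕ} (φ : EuclideanSpace ℝ (Fin m) → EuclideanSpace ℝ (Fin n)) : Prop :=
  ∀ f : EuclideanSpace ℝ (Fin n) → ℂ, MemPW n f → MemPW m (f ∘ φ)

/-!
Continuous maps `φ` preserving `PW` are exactly the injective affine maps.

Necessity uses one-variable complex analysis on lines. A function of class `PW(ℝᵐ)` restricted to
a line extends to an entire function of exponential type (`MemPW.exists_isExpType_line`). Fix
a line `t ↦ a + t b`, a vector `w`, and `f ∈ PW(ℝⁿ)` with `f (φ a) ≠ 0`, and put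
`lam t = (w, φ (a + t b))` and `p t = f (φ (a + t b))`. The class `PW(ℝⁿ)` is invariant under the
modulations `f ↦ exp (i k (w, ·)) f`, so all the products `exp (i k lam) p`, `k ∈ ℤ`, extend to
entire functions `Q k` of exponential type. Write `P = Q 0`. All powers of `Q 1 / P` and of
`Q (-1) / P` have the common denominator `P`, so these quotients have no poles
(`exists_entire_quotient`); being inverse to each other, they have the form `exp ψ` and `exp (-ψ)`
with `ψ` entire. As `P exp ψ` and `P exp (-ψ)` are of exponential type,
`|Re ψ z| ≤ C (1 + |z|) - log |P z|`, and Jensen's inequality for `log |P|` bounds the circle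
averages of `|Re ψ|` by a linear function of the radius. By the estimates of Harnack,
Borel–Carathéodory and Cauchy, `ψ` is affine (`deriv_eq_of_isExpType_mul_exp`), hence so is `lam`.
Therefore `φ` is affine on lines, and, being continuous, it is affine. It is injective by the
Riemann–Lebesgue lemma: functions of class `PW` vanish at infinity, while a nonzero constant on a
line does not.

Sufficiency (`MemPW.comp_linear`): composition with an injective linear map `L` pushes the spectrum
forward along the surjection `L*`. The new density is an integral over pieces of fibres of bounded
volume, so it is square integrable by the Cauchy–Schwarz inequality.
-/

open Complex MeasureTheory Filter Topology

/-! ### Entire functions: quotients, logarithms, growth -/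

/-- Entire functions of exponential type: `F` is entire and `‖F z‖ ≤ exp (C * (1 + ‖z‖))` for some
constant `C`. -/
def IsExpType (F : ℂ → ℂ) : Prop :=
  Differentiable ℂ F ∧ ∃ C : ℝ, ∀ z, ‖F z‖ ≤ Real.exp (C * (1 + ‖z‖))

theorem eq_of_eq_on_real {F G : ℂ → ℂ} (hF : Differentiable ℂ F) (hG : Differentiable ℂ G)
    (h : ∀ t : ℝ, F t = G t) : F = G := by
  have hFa : AnalyticOnNhd ℂ F Set.univ := fun z _ => hF.analyticAt z
  have hGa : AnalyticOnNhd ℂ G Set.univ := fun z _ => hG.analyticAt z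
  refine hFa.eq_of_frequently_eq hGa (z₀ := 0) ?_
  have h1 : Tendsto (fun t : ℝ => (t : ℂ)) (𝓝[≠] 0) (𝓝[≠] 0) := by
    refine tendsto_nhdsWithin_iff.2 ⟨?_, ?_⟩
    · have := (Complex.continuous_ofReal.tendsto 0).mono_left (nhdsWithin_le_nhds (s := {0}ᶜ))
      simpa using this
    · filter_upwards [self_mem_nhdsWithin] with t ht
      simpa using ht
  exact h1.frequently (Eventually.of_forall h).frequently

theorem mul_eq_zero_of_entire {F G : ℂ → ℂ} (hF : Differentiable ℂ F) (hG : Differentiable ℂ G)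
    {z₀ : ℂ} (h0 : F z₀ ≠ 0) (h : ∀ z, F z * G z = 0) (z : ℂ) : G z = 0 := by
  have hGa : AnalyticOnNhd ℂ G Set.univ := fun z _ => hG.analyticAt z
  have : G = 0 := by
    refine hGa.eq_of_eventuallyEq (fun z _ => analyticAt_const) (z₀ := z₀) ?_
    filter_upwards [hF.continuous.continuousAt.eventually_ne h0] with z hz
    simpa [hz] using h z
  simp [this]

/-- The ring of entire functions is completely integrally closed: if all powers of the quotient
`Q 1 / P` have `P` as a common denominator, then this quotient is entire. -/
theorem exists_entire_quotient {P : ℂ → ℂ} {Q : ℕ → ℂ → ℂ} (hP : Differentiable ℂ P)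
    (hQ : ∀ k, Differentiable ℂ (Q k)) {z₀ : ℂ} (hz₀ : P z₀ ≠ 0)
    (h : ∀ k z, P z ^ k * Q k z = P z * Q 1 z ^ k) :
    ∃ H : ℂ → ℂ, Differentiable ℂ H ∧ ∀ z, H z * P z = Q 1 z := by
  have hPa : ∀ z, AnalyticAt ℂ P z := fun z => hP.analyticAt z
  have hQa : ∀ k z, AnalyticAt ℂ (Q k) z := fun k z => (hQ k).analyticAt z
  have hPne : ∀ z, meromorphicOrderAt P z ≠ ⊤ := by
    intro z
    refine MeromorphicOn.meromorphicOrderAt_ne_top_of_isPreconnected (U := Set.univ)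
      (fun z _ => (hPa z).meromorphicAt) isPreconnected_univ (Set.mem_univ z₀) (Set.mem_univ z) ?_
    rw [((hPa z₀).meromorphicNFAt.meromorphicOrderAt_eq_zero_iff).2 hz₀]
    simp
  have hPev : ∀ z, ∀ᶠ w in 𝓝[≠] z, P w ≠ 0 := fun z =>
    (meromorphicOrderAt_ne_top_iff_eventually_ne_zero (hPa z).meromorphicAt).1 (hPne z)
  have hM : MeromorphicOn (Q 1 / P) Set.univ := fun z _ =>
    (hQa 1 z).meromorphicAt.div (hPa z).meromorphicAt
  have hord : ∀ z, 0 ≤ meromorphicOrderAt (Q 1 / P) z := by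
    intro z
    by_contra hneg
    push Not at hneg
    obtain ⟨p, hp⟩ := WithTop.ne_top_iff_exists.1 (hPne z)
    obtain ⟨q, hq⟩ := WithTop.ne_top_iff_exists.1 hneg.ne_top
    rw [← hq] at hneg
    have hq0 : q < 0 := by exact_mod_cast hneg
    -- `P * (Q 1 / P) ^ k` has the entire extension `Q k`
    have key : ∀ k : ℕ, 0 ≤ p + k * q := by
      intro k
      have h1 : meromorphicOrderAt (P * (Q 1 / P) ^ k) z = meromorphicOrderAt (Q k) z := by
        refine meromorphicOrderAt_congr ?_
        filter_upwards [hPev z] with w hw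
        have := h k w
        simp only [Pi.mul_apply, Pi.pow_apply, Pi.div_apply]
        rw [div_pow, mul_div_assoc', div_eq_iff (pow_ne_zero k hw)]
        linear_combination -this
      have h2 := (hQa k z).meromorphicOrderAt_nonneg
      rw [← h1, meromorphicOrderAt_mul (hPa z).meromorphicAt ((hM z trivial).pow k),
        meromorphicOrderAt_pow (hM z trivial), ← hp, ← hq] at h2
      exact_mod_cast h2
    have := key (p.natAbs + 1)
    push_cast at this
    have := neg_abs_le p
    have := le_abs_self p
    nlinarith [abs_nonneg p]
  have hHa : ∀ z, AnalyticAt ℂ (toMeromorphicNFOn (Q 1 / P) Set.univ) z := fun z => by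
    rw [← (meromorphicNFOn_toMeromorphicNFOn (Q 1 / P) Set.univ
      (Set.mem_univ z)).meromorphicOrderAt_nonneg_iff_analyticAt,
      meromorphicOrderAt_toMeromorphicNFOn hM (Set.mem_univ z)]
    exact hord z
  refine ⟨toMeromorphicNFOn (Q 1 / P) Set.univ, fun z => (hHa z).differentiableAt, fun z => ?_⟩
  have h1 : ∀ᶠ w in 𝓝[≠] z, toMeromorphicNFOn (Q 1 / P) Set.univ w * P w = Q 1 w := by
    filter_upwards [hM.toMeromorphicNFOn_eq_self_on_nhdsNE (Set.mem_univ z), hPev z] with w hw hPw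
    rw [hw, Pi.div_apply, div_mul_cancel₀ _ hPw]
  exact ((((hHa z).mul (hPa z)).frequently_eq_iff_eventually_eq (hQa 1 z)).1
    h1.frequently).self_of_nhds

theorem exists_entire_log {H : ℂ → ℂ} (hH : Differentiable ℂ H) (h0 : ∀ z, H z ≠ 0) :
    ∃ ψ : ℂ → ℂ, Differentiable ℂ ψ ∧ ∀ z, H z = exp (ψ z) := by
  have hd : Differentiable ℂ (fun z => deriv H z / H z) :=
    (hH.contDiff (n := 2)).differentiable_deriv_two.div hH h0
  obtain ⟨ψ, hψ0, hψ⟩ := hd.isExactOn_univ.with_val_at 0 (log (H 0))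
  have hψd : Differentiable ℂ ψ := fun z => (hψ z trivial).differentiableAt
  refine ⟨ψ, hψd, fun z => ?_⟩
  have hc : ∀ z, HasDerivAt (fun z => H z * exp (-ψ z)) 0 z := by
    intro z
    refine ((hH z).hasDerivAt.fun_mul ((hψ z trivial).fun_neg.cexp)).congr_deriv ?_
    have := h0 z
    field_simp
    ring
  have := is_const_of_deriv_eq_zero (fun z => (hc z).differentiableAt) (fun z => (hc z).deriv) z 0
  simp only [hψ0, exp_neg, exp_log (h0 0), mul_inv_cancel₀ (h0 0)] at this
  rwa [mul_inv_eq_one₀ (exp_ne_zero _)] at this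

/-- **Jensen's inequality** for the subharmonic function `log ‖f ·‖`. -/
theorem log_norm_le_circleAverage {f : ℂ → ℂ} (hf : Differentiable ℂ f) {c : ℂ} (hc : f c ≠ 0)
    {R : ℝ} (hR : 0 < R) :
    Real.log ‖f c‖ ≤ Real.circleAverage (fun z => Real.log ‖f z‖) c R := by
  have ha : AnalyticOnNhd ℂ f (Metric.closedBall c |R|) := fun z _ => hf.analyticAt z
  rw [ha.circleAverage_log_norm hR.ne' hc]
  refine le_add_of_nonneg_left (finsum_nonneg fun u => ?_)
  by_cases hu : u ∈ Metric.closedBall c |R|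
  · refine mul_nonneg (by exact_mod_cast MeromorphicOn.AnalyticOnNhd.divisor_nonneg ha u) ?_
    rcases eq_or_ne u c with rfl | huc
    · simp
    · have h1 : 0 < ‖c - u‖ := norm_pos_iff.2 (sub_ne_zero.2 huc.symm)
      refine Real.log_nonneg ?_
      rw [← div_eq_mul_inv, one_le_div h1]
      simpa [abs_of_pos hR, dist_eq_norm, norm_sub_rev] using hu
  · simp [hu]

/-- An entire function whose real part has circle averages of at most linear growth is affine. -/
theorem deriv_eq_of_circleAverage_le {ψ : ℂ → ℂ} (hψ : Differentiable ℂ ψ) {A : ℝ} (hA : 0 < A)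
    (h : ∀ R : ℝ, 0 < R → Real.circleAverage (fun z => |(ψ z).re|) 0 R ≤ A * (1 + R)) (z w : ℂ) :
    deriv ψ z = deriv ψ w := by
  -- On the circle of radius `4 * ρ` the Poisson kernel of a point of modulus less than `2 * ρ` lies
  -- between `0` and `(4 * ρ + 2 * ρ) / (4 * ρ - 2 * ρ) = 3`.
  have h1 : ∀ ρ : ℝ, 0 < ρ → ∀ w ∈ Metric.ball (0 : ℂ) (2 * ρ),
      (ψ w).re ≤ 3 * (A * (1 + 4 * ρ)) := by
    intro ρ hρ w hw
    have hw' : ‖w‖ < 2 * ρ := by simpa using hw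
    have hwb : w ∈ Metric.ball (0 : ℂ) (4 * ρ) := by
      simp only [Metric.mem_ball, dist_zero_right]; linarith
    have hcont : ContinuousOn (fun z => ((z - 0 + (w - 0)) / ((z - 0) - (w - 0))).re)
        (Metric.sphere (0 : ℂ) |4 * ρ|) := by
      refine continuous_re.comp_continuousOn (ContinuousOn.div (by fun_prop) (by fun_prop) ?_)
      intro z hz hzw
      have h1 : z = w := by simpa [sub_eq_zero] using hzw
      have h2 : ‖z‖ = 4 * ρ := by simpa [abs_of_pos hρ] using hz
      rw [h1] at h2
      linarith
    have hpois := DiffContOnCl.circleAverage_re_herglotzRieszKernel_smul' (c := 0) (R := 4 * ρ)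
      (hψ.diffContOnCl (s := Metric.ball 0 (4 * ρ))) hwb
    have hci : CircleIntegrable (fun z => ((z - 0 + (w - 0)) / ((z - 0) - (w - 0))).re • ψ z)
        0 (4 * ρ) :=
      (hcont.smul hψ.continuous.continuousOn).circleIntegrable'
    have hre := reCLM.circleAverage_comp_comm hci
    rw [hpois] at hre
    simp only [reCLM_apply] at hre
    rw [← hre]
    have hψc : Continuous (fun z => (ψ z).re) := continuous_re.comp hψ.continuous
    calc _ ≤ Real.circleAverage (fun z => 3 * |(ψ z).re|) 0 (4 * ρ) := by
          refine Real.circleAverage_mono ?_ ?_ ?_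
          · exact (continuous_re.comp_continuousOn
              (hcont.smul hψ.continuous.continuousOn)).circleIntegrable'
          · exact (Continuous.continuousOn (by fun_prop)).circleIntegrable'
          · intro z hz
            rw [abs_of_pos (by positivity)] at hz
            have hu := re_herglotzRieszKernel_le hz hwb
            have hl := le_re_herglotzRieszKernel hz hwb
            have hu3 : (4 * ρ + ‖w - 0‖) / (4 * ρ - ‖w - 0‖) ≤ 3 := by
              rw [sub_zero, div_le_iff₀ (by linarith)]; linarith
            have hl0 : 0 ≤ (4 * ρ - ‖w - 0‖) / (4 * ρ + ‖w - 0‖) := by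
              rw [sub_zero]; exact div_nonneg (by linarith) (by positivity)
            simp only [Function.comp_apply, reCLM_apply, real_smul, re_ofReal_mul]
            calc _ ≤ ((z - 0 + (w - 0)) / ((z - 0) - (w - 0))).re * |(ψ z).re| :=
                  mul_le_mul_of_nonneg_left (le_abs_self _) (hl0.trans hl)
              _ ≤ _ := mul_le_mul_of_nonneg_right (hu.trans hu3) (abs_nonneg _)
      _ = 3 * Real.circleAverage (fun z => |(ψ z).re|) 0 (4 * ρ) := by
          simpa using Real.circleAverage_fun_smul (a := (3 : ℝ)) (f := fun z => |(ψ z).re|)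
      _ ≤ _ := by
          have := h (4 * ρ) (by positivity)
          linarith
  -- Borel–Carathéodory on the ball of radius `2 * ρ`
  have h2 : ∀ ρ : ℝ, 0 < ρ → ∀ z : ℂ, ‖z‖ ≤ ρ → ‖ψ z‖ ≤ 6 * (A * (1 + 4 * ρ)) + 3 * ‖ψ 0‖ := by
    intro ρ hρ z hz
    have := borelCaratheodory (M := 3 * (A * (1 + 4 * ρ))) (by positivity) hψ.differentiableOn
      (h1 ρ hρ) (by positivity) (z := z) (by simp only [Metric.mem_ball, dist_zero_right]; linarith)
    refine this.trans (add_le_add ?_ ?_)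
    · rw [div_le_iff₀ (by linarith)]
      have : 0 < A * (1 + 4 * ρ) := by positivity
      nlinarith
    · rw [div_le_iff₀ (by linarith)]
      nlinarith [norm_nonneg (ψ 0)]
  -- Cauchy's estimate on the circle of radius `‖z‖ + 1` around `z` bounds `deriv ψ`, so Liouville's
  -- theorem applies.
  refine (hψ.contDiff (n := 2)).differentiable_deriv_two.apply_eq_apply_of_bounded ?_ z w
  refine isBounded_iff_forall_norm_le.2 ⟨54 * A + 3 * ‖ψ 0‖, ?_⟩
  rintro _ ⟨z, rfl⟩
  have h3 : ∀ u ∈ Metric.sphere z (‖z‖ + 1),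
      ‖ψ u‖ ≤ 6 * (A * (1 + 4 * (2 * ‖z‖ + 1))) + 3 * ‖ψ 0‖ := by
    intro u hu
    refine h2 _ (by positivity) u ?_
    have : ‖u - z‖ = ‖z‖ + 1 := by simpa using hu
    linarith [norm_le_norm_sub_add u z]
  refine (norm_deriv_le_of_forall_mem_sphere_norm_le (by positivity) hψ.diffContOnCl h3).trans ?_
  rw [div_le_iff₀ (by positivity)]
  nlinarith [norm_nonneg z, norm_nonneg (ψ 0), mul_nonneg hA.le (norm_nonneg z),
    mul_nonneg (norm_nonneg (ψ 0)) (norm_nonneg z)]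

/-! ### Exponential type and modulations of a real phase -/

/-- If `P * exp ψ` and `P * exp (-ψ)` are of exponential type and `P 0 ≠ 0`, then the entire
function `ψ` is affine: the circle averages of `log ‖P ·‖` are bounded below by Jensen's
inequality, hence those of `|Re ψ|` grow at most linearly. -/
theorem deriv_eq_of_isExpType_mul_exp {P ψ : ℂ → ℂ} (hP : Differentiable ℂ P) (hP0 : P 0 ≠ 0)
    (hψ : Differentiable ℂ ψ) (h₁ : IsExpType fun z => exp (ψ z) * P z)
    (h₂ : IsExpType fun z => exp (-ψ z) * P z) (z w : ℂ) : deriv ψ z = deriv ψ w := by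
  obtain ⟨-, C₁, hC₁⟩ := h₁
  obtain ⟨-, C₂, hC₂⟩ := h₂
  set C := max C₁ C₂
  refine deriv_eq_of_circleAverage_le hψ (A := |C| + |Real.log ‖P 0‖| + 1) (by positivity)
    (fun R hR => ?_) z w
  have hbound : ∀ z ∈ Metric.sphere (0 : ℂ) |R|, P z ≠ 0 →
      0 ≤ C * (1 + R) - Real.log ‖P z‖ - |(ψ z).re| := by
    intro z hz hPz
    have hzR : ‖z‖ = R := by simpa [abs_of_pos hR] using hz
    have hPn : ‖P z‖ ≠ 0 := norm_ne_zero_iff.2 hPz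
    have e₁ := Real.log_le_log (norm_pos_iff.2 (mul_ne_zero (exp_ne_zero _) hPz)) (hC₁ z)
    have e₂ := Real.log_le_log (norm_pos_iff.2 (mul_ne_zero (exp_ne_zero _) hPz)) (hC₂ z)
    rw [norm_mul, norm_exp, Real.log_mul (Real.exp_ne_zero _) hPn, Real.log_exp, Real.log_exp,
      hzR] at e₁ e₂
    have m₁ : C₁ * (1 + R) ≤ C * (1 + R) :=
      mul_le_mul_of_nonneg_right (le_max_left _ _) (by linarith)
    have m₂ : C₂ * (1 + R) ≤ C * (1 + R) :=
      mul_le_mul_of_nonneg_right (le_max_right _ _) (by linarith)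
    have : |(ψ z).re| ≤ C * (1 + R) - Real.log ‖P z‖ := by
      rw [neg_re] at e₂
      exact abs_le.2 ⟨by linarith, by linarith⟩
    linarith
  have hPa : AnalyticOnNhd ℂ P Set.univ := fun z _ => hP.analyticAt z
  -- Where `P` vanishes, `Real.log ‖P z‖` has the junk value `0` and `hbound` may fail, but these
  -- points are isolated and do not affect circle averages.
  have hcod : (fun z => C * (1 + R) - Real.log ‖P z‖ - |(ψ z).re|)
      =ᶠ[codiscreteWithin (Metric.sphere (0 : ℂ) |R|)]
      fun z => abs (C * (1 + R) - Real.log ‖P z‖ - |(ψ z).re|) := by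
    have hne : ∀ᶠ z in codiscreteWithin (Metric.sphere (0 : ℂ) |R|), P z ≠ 0 :=
      Filter.codiscreteWithin_mono (Set.subset_univ _) (hPa.preimage_zero_mem_codiscrete hP0)
    filter_upwards [hne, self_mem_codiscreteWithin _] with z hz hzs
    exact (abs_of_nonneg (hbound z hzs hz)).symm
  have hnn : 0 ≤ Real.circleAverage (fun z => C * (1 + R) - Real.log ‖P z‖ - |(ψ z).re|) 0 R := by
    rw [Real.circleAverage_congr_codiscreteWithin hcod hR.ne']
    exact Real.circleAverage_nonneg_of_nonneg fun z _ => abs_nonneg _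
  have hψc : Continuous (fun z => (ψ z).re) := continuous_re.comp hψ.continuous
  have i₁ : CircleIntegrable (fun z => Real.log ‖P z‖) 0 R :=
    MeromorphicOn.circleIntegrable_log_norm fun z _ => (hP.analyticAt z).meromorphicAt
  have i₂ : CircleIntegrable (fun z => |(ψ z).re|) 0 R :=
    (Continuous.continuousOn (by fun_prop)).circleIntegrable'
  have i₀ : CircleIntegrable (fun _ => C * (1 + R)) (0 : ℂ) R :=
    (Continuous.continuousOn (by fun_prop)).circleIntegrable'
  rw [Real.circleAverage_fun_sub (i₀.fun_sub i₁) i₂, Real.circleAverage_fun_sub i₀ i₁,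
    Real.circleAverage_const] at hnn
  have hJ := log_norm_le_circleAverage hP hP0 hR
  have e1 := le_abs_self C
  have e2 := neg_abs_le (Real.log ‖P 0‖)
  nlinarith [abs_nonneg (Real.log ‖P 0‖)]

/-- A continuous real function `lam` is affine if, for some `p` with `p 0 ≠ 0`, all the products
`exp (i k lam) p`, `k ∈ ℤ`, are restrictions to the real line of entire functions of exponential
type. -/
theorem affine_of_isExpType_modulations {lam : ℝ → ℝ} (hlam : Continuous lam) {p : ℝ → ℂ}
    (hp : p 0 ≠ 0)
    (h : ∀ k : ℤ, ∃ F, IsExpType F ∧ ∀ t : ℝ, F t = exp (k * lam t * I) * p t) :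
    ∃ s, ∀ t, lam t = lam 0 + s * t := by
  choose Q hQ hQr using h
  have hP : Differentiable ℂ (Q 0) := (hQ 0).1
  have hPr : ∀ t : ℝ, Q 0 t = p t := fun t => by simp [hQr]
  have hP0 : Q 0 0 ≠ 0 := by
    have := hPr 0
    rw [ofReal_zero] at this
    rwa [this]
  -- used with `ε = 1` and `ε = -1`
  have hpow : ∀ ε : ℤ, ∀ (k : ℕ) (z : ℂ),
      Q 0 z ^ k * Q (ε * k) z = Q 0 z * Q (ε * (1 : ℕ)) z ^ k := by
    intro ε k z
    refine congrFun (eq_of_eq_on_real (F := fun z => Q 0 z ^ k * Q (ε * k) z)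
      (G := fun z => Q 0 z * Q (ε * (1 : ℕ)) z ^ k) ((hP.pow k).mul (hQ _).1)
      (hP.mul ((hQ _).1.pow k)) fun t => ?_) z
    simp only [hQr, mul_pow, ← Complex.exp_nat_mul]
    push_cast
    simp only [zero_mul, mul_zero, exp_zero, one_mul, mul_one]
    rw [show (k : ℂ) * (ε * lam t * I) = ε * k * lam t * I by ring]
    ring
  obtain ⟨H, hH, hHP⟩ := exists_entire_quotient (Q := fun k : ℕ => Q (1 * k)) hP
    (fun k => (hQ _).1) hP0 (hpow 1)
  obtain ⟨H', hH', hHP'⟩ := exists_entire_quotient (Q := fun k : ℕ => Q (-1 * k)) hP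
    (fun k => (hQ _).1) hP0 (hpow (-1))
  have hQQ : ∀ z, Q (1 * (1 : ℕ)) z * Q (-1 * (1 : ℕ)) z = Q 0 z ^ 2 := by
    refine congrFun (eq_of_eq_on_real (F := fun z => Q (1 * (1 : ℕ)) z * Q (-1 * (1 : ℕ)) z)
      (G := fun z => Q 0 z ^ 2) ((hQ _).1.mul (hQ _).1) (hP.pow 2) fun t => ?_)
    simp only [hQr]
    push_cast
    rw [mul_mul_mul_comm, ← exp_add]
    simp [sq]
  have hHH : ∀ z, H z * H' z = 1 := by
    intro z
    have := mul_eq_zero_of_entire (hP.pow 2) ((hH.mul hH').sub_const 1) (z₀ := 0)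
      (by simpa using hP0) (fun z => by
        simp only [Pi.mul_apply, Pi.pow_apply]
        rw [← sub_eq_zero_of_eq (hQQ z)]
        have a := hHP z
        have b := hHP' z
        rw [← a, ← b]; ring) z
    exact sub_eq_zero.1 this
  obtain ⟨ψ, hψ, hHψ⟩ := exists_entire_log hH fun z hz => by simpa [hz] using hHH z
  have hHψ' : ∀ z, H' z = exp (-ψ z) := fun z => by
    rw [exp_neg, ← hHψ]; exact eq_inv_of_mul_eq_one_right (hHH z)
  have hder := deriv_eq_of_isExpType_mul_exp hP hP0 hψ
    (by simp only [← hHψ, hHP]; exact hQ _) (by simp only [← hHψ', hHP']; exact hQ _)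
  have hψaff : ∀ z, ψ z = ψ 0 + deriv ψ 0 * z := by
    intro z
    have hd : ∀ z, HasDerivAt (fun z => ψ z - deriv ψ 0 * z) 0 z := fun z => by
      refine ((hψ z).hasDerivAt.sub ((hasDerivAt_id z).const_mul (deriv ψ 0))).congr_deriv ?_
      rw [hder z 0]; ring
    have := is_const_of_deriv_eq_zero (fun z => (hd z).differentiableAt) (fun z => (hd z).deriv) z 0
    simp only [mul_zero, sub_zero] at this
    linear_combination this
  -- `H` agrees with `exp (i lam)` off the zeros of `P`, hence everywhere on the real line.
  have hHr : ∀ t : ℝ, exp (ψ t) = exp (lam t * I) := by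
    intro t
    have h1 : Tendsto (fun s : ℝ => (s : ℂ)) (𝓝[≠] t) (𝓝[≠] (t : ℂ)) :=
      tendsto_nhdsWithin_iff.2 ⟨(continuous_ofReal.tendsto t).mono_left nhdsWithin_le_nhds, by
        filter_upwards [self_mem_nhdsWithin] with s hs
        simpa using hs⟩
    have hPa : AnalyticOnNhd ℂ (Q 0) Set.univ := fun z _ => hP.analyticAt z
    have hne : ∀ᶠ z in 𝓝[≠] (t : ℂ), Q 0 z ≠ 0 := by
      refine ((hPa t trivial).eventually_eq_zero_or_eventually_ne_zero).resolve_left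
        fun h0 => hP0 ?_
      have := hPa.eq_of_eventuallyEq (g := 0) (fun z _ => analyticAt_const) h0
      simp [this]
    have hc₁ : Continuous (fun s : ℝ => exp (ψ s)) := by
      have := hψ.continuous
      fun_prop
    have hc₂ : Continuous (fun s : ℝ => exp (lam s * I)) := by fun_prop
    refine tendsto_nhds_unique_of_eventuallyEq
      ((hc₁.tendsto t).mono_left (nhdsWithin_le_nhds (s := {t}ᶜ)))
      ((hc₂.tendsto t).mono_left nhdsWithin_le_nhds) ?_
    filter_upwards [h1.eventually hne] with s hs
    have := hHP s
    simp only [hQr (1 * (1 : ℕ)) s] at this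
    rw [← hPr s, hHψ] at this
    simpa using mul_right_cancel₀ hs this
  -- By `hHr` the continuous function `(lam - Im ψ) / (2π)` takes integer values, so it is constant.
  have hdisc : DiscreteTopology (Set.range ((↑) : ℤ → ℝ)) :=
    Int.isClosedEmbedding_coe_real.isEmbedding.toHomeomorph.symm.isEmbedding.discreteTopology
  have hmaps : ∀ t : ℝ, (lam t - (ψ t).im) / (2 * Real.pi) ∈ Set.range ((↑) : ℤ → ℝ) := by
    intro t
    obtain ⟨n, hn⟩ := Complex.exp_eq_exp_iff_exists_int.1 (hHr t).symm
    refine ⟨n, ?_⟩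
    have := congrArg im hn
    simp at this
    rw [eq_div_iff (by positivity)]
    linarith
  have hconst := isPreconnected_univ.eqOn_const_of_mapsTo
    (S := Set.univ) ⟨hdisc⟩ (f := fun t : ℝ => (lam t - (ψ t).im) / (2 * Real.pi))
    (Continuous.continuousOn (by
      have := hψ.continuous
      fun_prop)) (fun t _ => hmaps t) ⟨0, ⟨0, by simp⟩⟩
  obtain ⟨y, -, hy⟩ := hconst
  refine ⟨(deriv ψ 0).im, fun t => ?_⟩
  have e := (hy (Set.mem_univ t)).trans (hy (Set.mem_univ 0)).symm
  simp only at e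
  rw [div_left_inj' (by positivity), hψaff t, hψaff ((0 : ℝ) : ℂ)] at e
  simp at e
  linarith

/-! ### The class `PW`: restriction to lines, symmetries, decay -/

theorem integrableOn_ball_of_memLp_two {n : ℕ} {g : EuclideanSpace ℝ (Fin n) → ℂ}
    (hg : MemLp g 2 volume) (c : EuclideanSpace ℝ (Fin n)) (r : ℝ) :
    IntegrableOn g (Metric.ball c r) := by
  have : IsFiniteMeasure (volume.restrict (Metric.ball c r)) :=
    ⟨by simpa using measure_ball_lt_top⟩
  exact (hg.restrict _).integrable one_le_two

/-- The restriction of a function of class `PW` to a line extends to an entire function of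
exponential type. -/
theorem MemPW.exists_isExpType_line {m : ℕ} {f : EuclideanSpace ℝ (Fin m) → ℂ} (hf : MemPW m f)
    (a b : EuclideanSpace ℝ (Fin m)) :
    ∃ F, IsExpType F ∧ ∀ t : ℝ, F t = f (a + t • b) := by
  obtain ⟨g, c, r, hg, hr, hfg⟩ := hf
  have hgi := integrableOn_ball_of_memLp_two hg c r
  set μ := volume.restrict (Metric.ball c r)
  set ρ := ‖c‖ + r
  have hρ : 0 < ρ := by positivity
  -- `ρ` bounds the spectrum of `f`, and `ρ * ‖b‖` that of its restriction to the line.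
  have hball : ∀ᵐ u ∂μ, |inner ℝ u b| ≤ ρ * ‖b‖ := by
    filter_upwards [ae_restrict_mem measurableSet_ball] with u hu
    refine (abs_real_inner_le_norm u b).trans (mul_le_mul_of_nonneg_right ?_ (norm_nonneg b))
    have : ‖u - c‖ < r := by simpa [dist_eq_norm] using hu
    have := norm_le_norm_sub_add u c
    simp only [ρ]
    linarith
  have hnorm : ∀ (z : ℂ) (u : EuclideanSpace ℝ (Fin m)), |inner ℝ u b| ≤ ρ * ‖b‖ →
      ‖exp (I * (((inner ℝ u a : ℝ) : ℂ) + z * ((inner ℝ u b : ℝ) : ℂ)))‖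
        ≤ Real.exp (ρ * ‖b‖ * ‖z‖) := by
    intro z u hu
    rw [norm_exp]
    refine Real.exp_le_exp.2 ?_
    have e : (I * (((inner ℝ u a : ℝ) : ℂ) + z * ((inner ℝ u b : ℝ) : ℂ))).re
        = -(z.im * inner ℝ u b) := by simp
    rw [e]
    refine (neg_le_abs _).trans ?_
    rw [abs_mul, mul_comm]
    exact mul_le_mul hu (abs_im_le_norm z) (abs_nonneg _) (by positivity)
  have hcont : ∀ z : ℂ, Continuous fun u : EuclideanSpace ℝ (Fin m) =>
      exp (I * (((inner ℝ u a : ℝ) : ℂ) + z * ((inner ℝ u b : ℝ) : ℂ))) := fun z => by fun_prop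
  have hint : ∀ z : ℂ, Integrable (fun u =>
      g u * exp (I * (((inner ℝ u a : ℝ) : ℂ) + z * ((inner ℝ u b : ℝ) : ℂ)))) μ := by
    intro z
    refine hgi.mul_bdd (c := Real.exp (ρ * ‖b‖ * ‖z‖)) (hcont z).aestronglyMeasurable ?_
    filter_upwards [hball] with u hu using hnorm z u hu
  refine ⟨fun z => ∫ u, g u * exp (I * (((inner ℝ u a : ℝ) : ℂ) + z * ((inner ℝ u b : ℝ) : ℂ))) ∂μ,
    ⟨fun z₀ => ?_, ?_⟩, fun t => ?_⟩
  · refine (hasDerivAt_integral_of_dominated_loc_of_deriv_le (μ := μ) (x₀ := z₀)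
      (F := fun z u => g u * exp (I * (((inner ℝ u a : ℝ) : ℂ) + z * ((inner ℝ u b : ℝ) : ℂ))))
      (F' := fun z u => g u * (exp (I * (((inner ℝ u a : ℝ) : ℂ) + z * ((inner ℝ u b : ℝ) : ℂ)))
        * (I * ((inner ℝ u b : ℝ) : ℂ))))
      (bound := fun u => ‖g u‖ * (Real.exp (ρ * ‖b‖ * (‖z₀‖ + 1)) * (ρ * ‖b‖)))
      (Metric.ball_mem_nhds z₀ one_pos)
      (Eventually.of_forall fun z => (hint z).aestronglyMeasurable) (hint z₀)
      ?_ ?_ ?_ ?_).2.differentiableAt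
    · exact hgi.aestronglyMeasurable.mul
        (Continuous.aestronglyMeasurable (by fun_prop))
    · filter_upwards [hball] with u hu z hz
      have hz' : ‖z‖ ≤ ‖z₀‖ + 1 := by
        have : ‖z - z₀‖ < 1 := by simpa [dist_eq_norm] using hz
        linarith [norm_le_norm_sub_add z z₀]
      rw [norm_mul, norm_mul]
      refine mul_le_mul_of_nonneg_left (mul_le_mul ((hnorm z u hu).trans ?_) ?_ (norm_nonneg _)
        (Real.exp_pos _).le) (norm_nonneg _)
      · exact Real.exp_le_exp.2 (mul_le_mul_of_nonneg_left hz' (by positivity))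
      · simpa using hu
    · exact hgi.norm.mul_const _
    · refine Eventually.of_forall fun u z _ => ?_
      have h1 : HasDerivAt
          (fun z : ℂ => I * (((inner ℝ u a : ℝ) : ℂ) + z * ((inner ℝ u b : ℝ) : ℂ)))
          (I * ((inner ℝ u b : ℝ) : ℂ)) z := by
        simpa using (((hasDerivAt_id z).mul_const ((inner ℝ u b : ℝ) : ℂ)).const_add
          ((inner ℝ u a : ℝ) : ℂ)).const_mul I
      exact h1.cexp.const_mul (g u)
  · set M := ∫ u, ‖g u‖ ∂μ
    have hM : 0 ≤ M := integral_nonneg fun u => norm_nonneg _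
    refine ⟨M + ρ * ‖b‖, fun z => ?_⟩
    calc _ ≤ ∫ u, ‖g u‖ * Real.exp (ρ * ‖b‖ * ‖z‖) ∂μ := by
          refine norm_integral_le_of_norm_le (hgi.norm.mul_const _) ?_
          filter_upwards [hball] with u hu
          rw [norm_mul]
          exact mul_le_mul_of_nonneg_left (hnorm z u hu) (norm_nonneg _)
      _ = M * Real.exp (ρ * ‖b‖ * ‖z‖) := integral_mul_const _ _
      _ ≤ Real.exp M * Real.exp (ρ * ‖b‖ * ‖z‖) := by
          refine mul_le_mul_of_nonneg_right ?_ (Real.exp_pos _).le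
          linarith [Real.add_one_le_exp M]
      _ ≤ _ := by
          rw [← Real.exp_add]
          refine Real.exp_le_exp.2 ?_
          nlinarith [norm_nonneg z, mul_nonneg hM (norm_nonneg z), mul_nonneg hρ.le (norm_nonneg b)]
  · rw [hfg]
    refine integral_congr_ae (Eventually.of_forall fun u => ?_)
    simp [inner_add_right, inner_smul_right]

theorem MemPW.comp_add_const {n : ℕ} {f : EuclideanSpace ℝ (Fin n) → ℂ} (hf : MemPW n f)
    (a : EuclideanSpace ℝ (Fin n)) : MemPW n fun x => f (x + a) := by
  obtain ⟨g, c, r, hg, hr, hfg⟩ := hf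
  have hc : Continuous fun u : EuclideanSpace ℝ (Fin n) => exp (I * ((inner ℝ u a : ℝ) : ℂ)) := by
    fun_prop
  refine ⟨fun u => g u * exp (I * ((inner ℝ u a : ℝ) : ℂ)), c, r, ?_, hr, fun t => ?_⟩
  · refine hg.of_le (hg.1.mul hc.aestronglyMeasurable) (Eventually.of_forall fun u => ?_)
    simp [norm_exp]
  · change f (t + a) = _
    rw [hfg]
    refine integral_congr_ae (Eventually.of_forall fun u => ?_)
    simp only [inner_add_right, ofReal_add, mul_add, exp_add]
    ring

/-- Modulation by `w` translates the spectrum by `w`. -/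
theorem MemPW.exp_inner_mul {n : ℕ} {f : EuclideanSpace ℝ (Fin n) → ℂ} (hf : MemPW n f)
    (w : EuclideanSpace ℝ (Fin n)) :
    MemPW n fun x => exp (((inner ℝ w x : ℝ) : ℂ) * I) * f x := by
  obtain ⟨g, c, r, hg, hr, hfg⟩ := hf
  refine ⟨fun u => g (u - w), c + w, r,
    hg.comp_measurePreserving (measurePreserving_sub_right volume w), hr, fun t => ?_⟩
  change exp (((inner ℝ w t : ℝ) : ℂ) * I) * f t = _
  rw [hfg, ← integral_const_mul, ← integral_indicator measurableSet_ball,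
    ← integral_indicator measurableSet_ball, ← integral_sub_right_eq_self _ w]
  refine integral_congr_ae (Eventually.of_forall fun u => ?_)
  have hmem : u - w ∈ Metric.ball c r ↔ u ∈ Metric.ball (c + w) r := by
    simp [dist_eq_norm, sub_sub, add_comm]
  by_cases hu : u ∈ Metric.ball (c + w) r
  · simp only [Set.indicator_of_mem hu, Set.indicator_of_mem (hmem.2 hu)]
    rw [mul_left_comm, ← exp_add, inner_sub_left]
    congr 2
    push_cast
    ring
  · simp only [Set.indicator_of_notMem hu, Set.indicator_of_notMem (mt hmem.1 hu)]

/-- The witness is the inverse Fourier transform of the indicator of the unit ball, translated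
so that its value at `x₀` is the volume of that ball. -/
theorem exists_memPW_apply_ne_zero {n : ℕ} (x₀ : EuclideanSpace ℝ (Fin n)) :
    ∃ f, MemPW n f ∧ f x₀ ≠ 0 := by
  have h : MemPW n fun t => ∫ u in Metric.ball (0 : EuclideanSpace ℝ (Fin n)) 1,
      (Metric.ball (0 : EuclideanSpace ℝ (Fin n)) 1).indicator (fun _ => (1 : ℂ)) u *
        exp (I * ((inner ℝ u t : ℝ) : ℂ)) :=
    ⟨_, 0, 1, memLp_indicator_const 2 measurableSet_ball 1 (Or.inr measure_ball_lt_top.ne),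
      one_pos, fun t => rfl⟩
  refine ⟨_, h.comp_add_const (-x₀), ?_⟩
  have : (∫ u in Metric.ball (0 : EuclideanSpace ℝ (Fin n)) 1,
      (Metric.ball (0 : EuclideanSpace ℝ (Fin n)) 1).indicator (fun _ => (1 : ℂ)) u) ≠ 0 := by
    rw [setIntegral_indicator measurableSet_ball, Set.inter_self, setIntegral_const]
    simp only [ne_eq, smul_eq_zero, one_ne_zero, or_false]
    exact (ENNReal.toReal_pos (Metric.measure_ball_pos volume _ one_pos).ne'
      measure_ball_lt_top.ne).ne'
  simpa using this

/-- The Riemann–Lebesgue lemma for functions of class `PW`. -/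
theorem MemPW.tendsto_cocompact {n : ℕ} {f : EuclideanSpace ℝ (Fin n) → ℂ} (hf : MemPW n f) :
    Tendsto f (cocompact _) (𝓝 0) := by
  obtain ⟨g, c, r, -, -, hfg⟩ := hf
  have h1 := tendsto_integral_exp_inner_smul_cocompact ((Metric.ball c r).indicator g)
  have hπ : (-(2 * Real.pi)⁻¹ : ℝ) ≠ 0 := by
    have := Real.pi_pos
    exact neg_ne_zero.2 (by positivity)
  have h2 := h1.comp (Homeomorph.smulOfNeZero (-(2 * Real.pi)⁻¹ : ℝ) hπ
    (α := EuclideanSpace ℝ (Fin n))).isClosedEmbedding.tendsto_cocompact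
  refine h2.congr fun t => ?_
  rw [hfg, ← integral_indicator measurableSet_ball]
  refine integral_congr_ae (Eventually.of_forall fun u => ?_)
  by_cases hu : u ∈ Metric.ball c r
  · simp only [Set.indicator_of_mem hu]
    rw [Circle.smul_def, Real.fourierChar_apply, smul_eq_mul, mul_comm]
    congr 2
    have : (Real.pi : ℂ) ≠ 0 := ofReal_ne_zero.2 Real.pi_ne_zero
    simp only [Homeomorph.smulOfNeZero_apply, inner_smul_right]
    push_cast
    field_simp
  · simp only [Set.indicator_of_notMem hu, smul_zero]

/-! ### Superposition with affine maps, and the characterization -/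

/-- Over a finite measure, integrating out the second variable preserves square integrability. -/
theorem memLp_two_integral_prod_right {α β : Type*} [MeasurableSpace α] [MeasurableSpace β]
    {μ : Measure α} {ν : Measure β} [SFinite μ] [IsFiniteMeasure ν] {G : α × β → ℂ}
    (hG : MemLp G 2 (μ.prod ν)) : MemLp (fun x => ∫ y, G (x, y) ∂ν) 2 μ := by
  refine ⟨hG.1.integral_prod_right', ?_⟩
  have h2 : (2 : ENNReal).toReal = (2 : ℝ) := by simp
  rw [eLpNorm_lt_top_iff_lintegral_rpow_enorm_lt_top two_ne_zero ENNReal.ofNat_ne_top, h2]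
  have hGl := lintegral_rpow_enorm_lt_top_of_eLpNorm_lt_top two_ne_zero ENNReal.ofNat_ne_top hG.2
  rw [h2, lintegral_prod _ (hG.1.enorm.pow_const _)] at hGl
  have hbound : ∀ᵐ x ∂μ, ‖∫ y, G (x, y) ∂ν‖ₑ ^ (2 : ℝ) ≤
      ν Set.univ * ∫⁻ y, ‖G (x, y)‖ₑ ^ (2 : ℝ) ∂ν := by
    filter_upwards [hG.1.prodMk_left] with x hx
    have h1 := eLpNorm_le_eLpNorm_mul_rpow_measure_univ (p := 1) (q := 2) one_le_two hx
    rw [eLpNorm_one_eq_lintegral_enorm,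
      eLpNorm_eq_lintegral_rpow_enorm_toReal two_ne_zero ENNReal.ofNat_ne_top, h2] at h1
    have h3 := ENNReal.rpow_le_rpow ((enorm_integral_le_lintegral_enorm _).trans h1) zero_le_two
    refine h3.trans_eq ?_
    rw [ENNReal.mul_rpow_of_nonneg _ _ zero_le_two, ← ENNReal.rpow_mul, ← ENNReal.rpow_mul,
      mul_comm]
    norm_num
  calc _ ≤ ∫⁻ x, ν Set.univ * ∫⁻ y, ‖G (x, y)‖ₑ ^ (2 : ℝ) ∂ν ∂μ := lintegral_mono_ae hbound
    _ = ν Set.univ * ∫⁻ x, ∫⁻ y, ‖G (x, y)‖ₑ ^ (2 : ℝ) ∂ν ∂μ :=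
        lintegral_const_mul' _ _ (measure_ne_top ν _)
    _ < ⊤ := ENNReal.mul_lt_top (measure_lt_top ν _) hGl

/-- Composition with an injective linear map `L` preserves `PW`. The spectrum is pushed forward
along the surjection `T = L*`; its density is the integral over the fibres of `T`, whose
intersections with the original ball have bounded volume. -/
theorem MemPW.comp_linear {m n : ℕ} {f : EuclideanSpace ℝ (Fin n) → ℂ} (hf : MemPW n f)
    (L : EuclideanSpace ℝ (Fin m) →ₗ[ℝ] EuclideanSpace ℝ (Fin n)) (hL : Function.Injective L) :
    MemPW m fun t => f (L t) := by
  obtain ⟨g, c, r, hg, hr, hfg⟩ := hf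
  set T := L.adjoint
  have hT : T.range = ⊤ := by
    rw [← Submodule.orthogonal_eq_bot_iff, LinearMap.orthogonal_range, LinearMap.adjoint_adjoint]
    exact LinearMap.ker_eq_bot.2 hL
  let K := T.ker
  let S : EuclideanSpace ℝ (Fin n) →ₗ[ℝ] K := (K.orthogonalProjectionOnto).toLinearMap
  have hS : S.range = ⊤ := LinearMap.range_eq_top.2 fun k =>
    ⟨k, K.orthogonalProjectionOnto_mem_subspace_eq_self k⟩
  have hSk : S.ker = Kᗮ := K.ker_orthogonalProjectionOnto
  -- `e u = (T u, S u)`: the first component is the spectral variable of `f ∘ L`, the second one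
  -- parametrizes the fibre of `T`.
  let e := (LinearMap.equivProdOfSurjectiveOfIsCompl T S hT hS
    (by rw [hSk]; exact K.isCompl_orthogonal)).toContinuousLinearEquiv
  -- the volume on the fibre, scaled to make `e` volume preserving
  obtain ⟨ν, hνfin, hνs, hmap⟩ : ∃ ν : Measure K, IsFiniteMeasureOnCompacts ν ∧ SFinite ν ∧
      (volume : Measure (EuclideanSpace ℝ (Fin n))).map e = volume.prod ν := by
    refine ⟨Measure.addHaarScalarFactor
      ((volume : Measure (EuclideanSpace ℝ (Fin n))).map e) (volume.prod volume) • volume,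
      inferInstance, inferInstance, ?_⟩
    rw [Measure.prod_smul_right]
    exact Measure.isAddLeftInvariant_eq_smul _ _
  have hmp : MeasurePreserving e volume (volume.prod ν) := ⟨e.continuous.measurable, hmap⟩
  have hemb : MeasurableEmbedding e := e.toHomeomorph.measurableEmbedding
  set ρ := ‖(e : EuclideanSpace ℝ (Fin n) →L[ℝ] EuclideanSpace ℝ (Fin m) × K)‖ * (‖c‖ + r) + 1
  have hρ : 0 < ρ := by positivity
  -- both components of the image of the ball under `e` lie in balls of radius `ρ`
  have hball : ∀ u ∈ Metric.ball c r, ‖e u‖ < ρ := by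
    intro u hu
    have h1 := (e : EuclideanSpace ℝ (Fin n) →L[ℝ] EuclideanSpace ℝ (Fin m) × K).le_opNorm u
    have h2 : ‖u‖ ≤ ‖c‖ + r := by
      have : ‖u - c‖ < r := by simpa [dist_eq_norm] using hu
      linarith [norm_le_norm_sub_add u c]
    have h3 := mul_le_mul_of_nonneg_left h2
      (norm_nonneg (e : EuclideanSpace ℝ (Fin n) →L[ℝ] EuclideanSpace ℝ (Fin m) × K))
    simp only [ContinuousLinearEquiv.coe_coe] at h1
    simp only [ρ]
    linarith
  let g₀ := (Metric.ball c r).indicator g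
  have hg₀ : MemLp g₀ 2 := hg.indicator measurableSet_ball
  have hg₀i : Integrable g₀ :=
    (integrable_indicator_iff measurableSet_ball).2 (integrableOn_ball_of_memLp_two hg c r)
  let G : EuclideanSpace ℝ (Fin m) × K → ℂ := fun p => g₀ (e.symm p)
  have hGe : ∀ u, G (e u) = g₀ u := fun u => by simp [G]
  have hmps : MeasurePreserving e.symm (volume.prod ν) volume := by
    refine ⟨e.symm.continuous.measurable, ?_⟩
    rw [← hmap, Measure.map_map e.symm.continuous.measurable e.continuous.measurable]
    simp
  have hG : MemLp G 2 (volume.prod ν) := hg₀.comp_measurePreserving hmps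
  have hGi : Integrable G (volume.prod ν) := hmps.integrable_comp_of_integrable hg₀i
  have hG0 : ∀ p, ρ ≤ ‖p‖ → G p = 0 := by
    intro p hp
    refine Set.indicator_of_notMem (fun hu => ?_) g
    have := hball _ hu
    rw [e.apply_symm_apply] at this
    linarith
  let B := Metric.ball (0 : K) ρ
  have : IsFiniteMeasure (ν.restrict B) := ⟨by
    rw [Measure.restrict_apply_univ]; exact measure_ball_lt_top⟩
  let h : EuclideanSpace ℝ (Fin m) → ℂ := fun v => ∫ k, G (v, k) ∂(ν.restrict B)
  have hh : ∀ v, h v = ∫ k, G (v, k) ∂ν := fun v => by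
    refine setIntegral_eq_integral_of_forall_compl_eq_zero fun k hk => hG0 _ ?_
    have : ρ ≤ ‖k‖ := by simpa [B] using hk
    exact this.trans (le_max_right _ _)
  refine ⟨h, 0, ρ, memLp_two_integral_prod_right (hG.mono_measure ?_), hρ, fun t => ?_⟩
  · exact Measure.prod_mono le_rfl Measure.restrict_le_self
  have hEc : Continuous fun p : EuclideanSpace ℝ (Fin m) × K =>
      exp (I * ((inner ℝ p.1 t : ℝ) : ℂ)) := by fun_prop
  have hint : Integrable (fun p => G p * exp (I * ((inner ℝ p.1 t : ℝ) : ℂ))) (volume.prod ν) :=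
    hGi.mul_bdd (c := 1) hEc.aestronglyMeasurable (Eventually.of_forall fun p => by simp [norm_exp])
  calc f (L t) = ∫ u, G (e u) * exp (I * ((inner ℝ (e u).1 t : ℝ) : ℂ)) := by
        rw [hfg, ← integral_indicator measurableSet_ball]
        refine integral_congr_ae (Eventually.of_forall fun u => ?_)
        have hin : inner ℝ (e u).1 t = inner ℝ u (L t) := L.adjoint_inner_left t u
        simp only [hGe, hin, g₀]
        by_cases hu : u ∈ Metric.ball c r
        · simp only [Set.indicator_of_mem hu]
        · simp only [Set.indicator_of_notMem hu, zero_mul]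
    _ = ∫ p, G p * exp (I * ((inner ℝ p.1 t : ℝ) : ℂ)) ∂(volume.prod ν) :=
        hmp.integral_comp hemb (fun p => G p * exp (I * ((inner ℝ p.1 t : ℝ) : ℂ)))
    _ = ∫ v, h v * exp (I * ((inner ℝ v t : ℝ) : ℂ)) := by
        rw [integral_prod _ hint]
        simp only [integral_mul_const, hh]
    _ = _ := by
        refine (setIntegral_eq_integral_of_forall_compl_eq_zero fun v hv => ?_).symm
        have hv' : ρ ≤ ‖v‖ := by simpa using hv
        have : h v = 0 := integral_eq_zero_of_ae (Eventually.of_forall fun k =>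
          hG0 _ (hv'.trans (le_max_left _ _)))
        rw [this, zero_mul]

theorem preservesPW_of_affine {m n : ℕ}
    (A : EuclideanSpace ℝ (Fin m) →ᵃ[ℝ] EuclideanSpace ℝ (Fin n)) (hA : Function.Injective A) :
    PreservesPW A := by
  intro f hf
  have := (hf.comp_add_const (A 0)).comp_linear A.linear (A.linear_injective_iff.2 hA)
  convert this using 1
  ext t
  have := A.map_vadd 0 t
  simp only [vadd_eq_add, add_zero] at this
  simp [this]

/-- A continuous map preserving `PW` is affine on every line: if `f ∈ PW` does not vanish at `φ a`,
then the modulations `exp (i k (w, x)) f`, `k ∈ ℤ`, are again in `PW`, so their compositions with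
`φ` have extensions of exponential type along the line. -/
theorem PreservesPW.affine_on_line {m n : ℕ}
    {φ : EuclideanSpace ℝ (Fin m) → EuclideanSpace ℝ (Fin n)} (hφ : Continuous φ)
    (h : PreservesPW φ) (a b : EuclideanSpace ℝ (Fin m)) (w : EuclideanSpace ℝ (Fin n)) :
    ∃ s : ℝ, ∀ t : ℝ, inner ℝ w (φ (a + t • b)) = inner ℝ w (φ a) + s * t := by
  obtain ⟨f, hf, hf0⟩ := exists_memPW_apply_ne_zero (φ a)
  obtain ⟨s, hs⟩ := affine_of_isExpType_modulations
    (lam := fun t => inner ℝ w (φ (a + t • b))) (p := fun t => f (φ (a + t • b)))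
    (by fun_prop) (by simpa using hf0) fun k => by
      obtain ⟨F, hF, hFt⟩ := (h _ (hf.exp_inner_mul ((k : ℝ) • w))).exists_isExpType_line a b
      exact ⟨F, hF, fun t => by simp [hFt, inner_smul_left]⟩
  exact ⟨s, fun t => by simpa using hs t⟩

theorem PreservesPW.map_midpoint {m n : ℕ}
    {φ : EuclideanSpace ℝ (Fin m) → EuclideanSpace ℝ (Fin n)} (hφ : Continuous φ)
    (h : PreservesPW φ) (x y : EuclideanSpace ℝ (Fin m)) :
    φ (midpoint ℝ x y) = midpoint ℝ (φ x) (φ y) := by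
  refine ext_inner_left ℝ fun w => ?_
  obtain ⟨s, hs⟩ := h.affine_on_line hφ x (y - x) w
  have h1 := hs 1
  have h2 := hs (1 / 2)
  have e1 : x + (1 : ℝ) • (y - x) = y := by simp
  have e2 : x + (1 / 2 : ℝ) • (y - x) = midpoint ℝ x y := by
    rw [midpoint_eq_smul_add, invOf_eq_inv]
    module
  rw [e1] at h1
  rw [e2] at h2
  rw [h2, midpoint_eq_smul_add, invOf_eq_inv, inner_smul_right, inner_add_right, h1]
  ring

/-- An affine map preserving `PW` is injective: otherwise some `f ∘ A` with `f ∈ PW` is a nonzero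
constant on a line, against the Riemann–Lebesgue lemma. -/
theorem PreservesPW.injective {m n : ℕ}
    {A : EuclideanSpace ℝ (Fin m) →ᵃ[ℝ] EuclideanSpace ℝ (Fin n)} (h : PreservesPW A) :
    Function.Injective A := by
  rw [← A.linear_injective_iff, injective_iff_map_eq_zero]
  intro b hb
  by_contra hb0
  obtain ⟨f, hf, hf0⟩ := exists_memPW_apply_ne_zero (A 0)
  have h1 := (h f hf).tendsto_cocompact
  have h2 : Tendsto (fun k : ℕ => (k : ℝ) • b) atTop (cocompact _) := by
    rw [← Metric.cobounded_eq_cocompact, ← tendsto_norm_atTop_iff_cobounded]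
    simp only [norm_smul, Real.norm_natCast]
    exact tendsto_natCast_atTop_atTop.atTop_mul_const (norm_pos_iff.2 hb0)
  have h3 : ∀ k : ℕ, (f ∘ A) ((k : ℝ) • b) = f (A 0) := fun k => by
    have := A.map_vadd 0 ((k : ℝ) • b)
    simp only [vadd_eq_add, add_zero, map_smul, hb, smul_zero, zero_add] at this
    simp [this]
  have h4 := h1.comp h2
  simp only [Function.comp_def] at h4 h3
  simp only [h3] at h4
  exact hf0 (tendsto_nhds_unique tendsto_const_nhds h4)

theorem preservesPW_iff {m n : ℕ} {φ : EuclideanSpace ℝ (Fin m) → EuclideanSpace ℝ (Fin n)}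
    (hφ : Continuous φ) :
    PreservesPW φ ↔ ∃ A : EuclideanSpace ℝ (Fin m) →ᵃ[ℝ] EuclideanSpace ℝ (Fin n),
      Function.Injective A ∧ φ = A := by
  refine ⟨fun h => ?_, ?_⟩
  · have hA : φ = AffineMap.ofMapMidpoint φ (h.map_midpoint hφ) hφ := rfl
    exact ⟨_, PreservesPW.injective (hA ▸ h), hA⟩
  · rintro ⟨A, hA, rfl⟩
    exact preservesPW_of_affine A hA

theorem mainTheorem1 :
    (∀ (m n : ℕ) (φ : EuclideanSpace ℝ (Fin m) → EuclideanSpace ℝ (Fin n)), Continuous φ →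
      (PreservesPW φ ↔
        ∃ A : EuclideanSpace ℝ (Fin m) →ᵃ[ℝ] EuclideanSpace ℝ (Fin n),
          Function.Injective A ∧ φ = A)) ∧
    (∀ m n : ℕ, n < m →
      ¬ ∃ φ : EuclideanSpace ℝ (Fin m) → EuclideanSpace ℝ (Fin n),
        Continuous φ ∧ PreservesPW φ) ∧
    (∀ (n : ℕ) (φ : EuclideanSpace ℝ (Fin n) → EuclideanSpace ℝ (Fin n)), Continuous φ →
      (PreservesPW φ ↔
        ∃ A : EuclideanSpace ℝ (Fin n) ≃ᵃ[ℝ] EuclideanSpace ℝ (Fin n), φ = A)) := by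
  refine ⟨fun m n φ hφ => preservesPW_iff hφ, ?_, fun n φ hφ => (preservesPW_iff hφ).trans ?_⟩
  · rintro m n hmn ⟨φ, hφ, h⟩
    obtain ⟨A, hA, -⟩ := (preservesPW_iff hφ).1 h
    have := LinearMap.finrank_le_finrank_of_injective (A.linear_injective_iff.2 hA)
    simp only [finrank_euclideanSpace, Fintype.card_fin] at this
    omega
  · constructor
    · rintro ⟨A, hA, rfl⟩
      have hL := A.linear_injective_iff.2 hA
      have hs : Function.Surjective A :=
        A.linear_surjective_iff.1 (LinearMap.injective_iff_surjective.1 hL)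
      exact ⟨AffineEquiv.ofBijective ⟨hA, hs⟩, rfl⟩
    · rintro ⟨A, rfl⟩
      exact ⟨A, A.injective, rfl⟩
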